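/- Let $k$ and $N$ be integers with $1\le k<N$. For a real symmetric $N\times N$ matrix $X$ with eigenvalues $\lambda_1(X)\le\dots\le\lambda_N(X)$, counted with multiplicity, set $$\mathcal P^-_k(X)=\sum_{i=1}^k\lambda_i(X),\qquad \mathcal P^+_k(X)=\sum_{i=N-k+1}^N\lambda_i(X).$$ For $F\in\{\mathcal P^-_k,\mathcal P^+_k\}$, a classical solution (respectively classical supersolution) of $F(D^2u)=0$ in $\mathbb R^N$ is a function $u\in C^2(\mathbb R^N)$ with $F(D^2u(x))=0$ (respectively $\le 0$) for all $x\in\mathbb R^N$. A viscosity supersolution is a lower semicontinuous function $u:\mathbb R^N\to\mathbb R$ such that $F(D^2\varphi(x))\le 0$ whenever $x\in\mathbb R^N$, $\varphi$ is a real function of class $C^2$ near $x$, and $u-\varphi$ has a local minimum at $x$. 1. For $F=\mathcal P^-_k$ there exist nonnegative, nonconstant classical solutions of $F(D^2u)=0$ in $\mathbb R^N$. In particular, for every nonconstant convex function $f\in C^2(\mathbb R)$ with $f\ge 0$ and every $i\in\{1,\dots,N\}$, the function $u(x)=f(x_i)$ is one. 2. For $F=\mathcal P^+_k$ with $k=1$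 or $k=2$, every nonnegative viscosity supersolution of $F(D^2u)=0$ in $\mathbb R^N$ is constant. 3. For $F=\mathcal P^+_k$ with $k>2$ there exist nonnegative, bounded, nonconstant classical supersolutions of $F(D^2u)=0$ in $\mathbb R^N$. -/

import Mathlib

/-- The space of real symmetric `N × N` matrices. -/
abbrev SymMatrix (N : ℕ) : Type := {X : Matrix (Fin N) (Fin N) ℝ // X.IsSymm}

theorem SymMatrix.isHermitian {N : ℕ} (X : SymMatrix N) : X.1.IsHermitian := by
  have h := X.2
  rw [Matrix.IsHermitian, Matrix.conjTranspose_eq_transpose_of_trivial]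
  exact h

/-- The eigenvalues of `X`, repeated according to multiplicity, in nondecreasing order:
`orderedEigenvalue X 0 ≤ ⋯ ≤ orderedEigenvalue X (N - 1)`. (Mathlib's `eigenvalues₀` lists them in
nonincreasing order, whence `Fin.rev`.) -/
noncomputable def orderedEigenvalue {N : ℕ} (X : SymMatrix N) (i : Fin N) : ℝ :=
  X.isHermitian.eigenvalues₀ (Fin.cast (Fintype.card_fin N).symm i.rev)

/-- The sum of the `k` smallest eigenvalues (indices `0, …, k - 1`). -/
noncomputable def partialSumMinus {N : ℕ} (k : ℕ) (X : SymMatrix N) : ℝ :=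
  ∑ i : Fin N with i.val < k, orderedEigenvalue X i

/-- The sum of the `k` largest eigenvalues (indices `N - k, …, N - 1`). -/
noncomputable def partialSumPlus {N : ℕ} (k : ℕ) (X : SymMatrix N) : ℝ :=
  ∑ i : Fin N with N ≤ i.val + k, orderedEigenvalue X i

/-- The matrix of second partial derivatives of `u` at `x`. -/
noncomputable def hessianMatrix {N : ℕ} (u : EuclideanSpace ℝ (Fin N) → ℝ)
    (x : EuclideanSpace ℝ (Fin N)) : Matrix (Fin N) (Fin N) ℝ :=
  Matrix.of fun i j =>
    fderiv ℝ (fderiv ℝ u) x (EuclideanSpace.single i 1) (EuclideanSpace.single j 1)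

theorem hessianMatrix_isSymm {N : ℕ} {u : EuclideanSpace ℝ (Fin N) → ℝ}
    {x : EuclideanSpace ℝ (Fin N)} (hu : ContDiffAt ℝ 2 u x) : (hessianMatrix u x).IsSymm := by
  have h : IsSymmSndFDerivAt ℝ u x := hu.isSymmSndFDerivAt (by simp)
  refine Matrix.IsSymm.ext fun i j => ?_
  exact h.eq _ _

/-- The Hessian `D²u(x)` of a function that is `C²` near `x`, as a symmetric matrix. -/
noncomputable def hessian {N : ℕ} (u : EuclideanSpace ℝ (Fin N) → ℝ)
    (x : EuclideanSpace ℝ (Fin N)) (hu : ContDiffAt ℝ 2 u x) : SymMatrix N :=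
  ⟨hessianMatrix u x, hessianMatrix_isSymm hu⟩

/-- `u` is of class `C²` and `F(D²u) = 0` everywhere in `ℝᴺ`. -/
def IsClassicalSolution {N : ℕ} (F : SymMatrix N → ℝ) (u : EuclideanSpace ℝ (Fin N) → ℝ) : Prop :=
  ∃ hu : ContDiff ℝ 2 u, ∀ x, F (hessian u x hu.contDiffAt) = 0

/-- `u` is of class `C²` and `F(D²u) ≤ 0` everywhere in `ℝᴺ`. -/
def IsClassicalSupersolution {N : ℕ} (F : SymMatrix N → ℝ)
    (u : EuclideanSpace ℝ (Fin N) → ℝ) : Prop :=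
  ∃ hu : ContDiff ℝ 2 u, ∀ x, F (hessian u x hu.contDiffAt) ≤ 0

/-- `u` is a viscosity supersolution of `F(D²u) = 0` in `ℝᴺ`: it is lower semicontinuous, and
`F(D²φ(x)) ≤ 0` whenever `φ` is `C²` near `x` and `u - φ` has a local minimum at `x`. -/
def IsViscositySupersolution {N : ℕ} (F : SymMatrix N → ℝ)
    (u : EuclideanSpace ℝ (Fin N) → ℝ) : Prop :=
  LowerSemicontinuous u ∧
    ∀ (x : EuclideanSpace ℝ (Fin N)) (φ : EuclideanSpace ℝ (Fin N) → ℝ)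
      (hφ : ContDiffAt ℝ 2 φ x),
      IsLocalMin (fun y => u y - φ y) x → F (hessian φ x hφ) ≤ 0

/-!
Everything rests on one spectral computation. The matrix `α I + β v vᵀ` with `β ≥ 0` has
top eigenvalue `α + β |v|²` and its `N - 1` remaining eigenvalues equal to `α`
(`orderedEigenvalue_of_rankOneUpdate`), so for `1 ≤ k < N` the partial sums are
`P⁺_k = kα + β |v|²` and `P⁻_k = kα`. By the chain rule (`fderiv_fderiv_comp_apply`) the Hessians of
all the functions needed below have this form.

* For `f` convex, the Hessian of `f(x_i)` is `f''(x_i) eᵢ eᵢᵀ` with `f'' ≥ 0`; here `α = 0`, so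
  `P⁻_k` vanishes.
* For `u(x) = C (b + |x - x₀|²)^(-a)`, writing `s = |x - x₀|²` and `t = b + s`, one finds
  `P⁺_k(D²u) = 2aC t^(-a-2) (2(a+1)s - kt)` (`partialSumPlus_hessian_inversePower`). With `b = 1`,
  `a = 1/2` this is nonpositive as soon as `k ≥ 3`, which gives the bounded supersolutions. With
  `b = 0` and `k ≤ 2` it is positive for every `a > 0`.
* The last remark gives a comparison in exterior domains: a nonnegative viscosity supersolution `u`
  with `u ≥ c` on a closed ball of radius `ρ` satisfies `u ≥ c (ρ / |x - x₀|)^(2a)` outside it, since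
  otherwise `u` minus the right-hand side, which is nonnegative on the sphere and almost nonnegative
  at infinity, has an interior minimum, where the barrier `φ` has `P⁺_k(D²φ) > 0`, against the
  definition of a supersolution. Letting `a → 0` yields `u ≥ c` everywhere (`IsViscositySupersolution.le_of_le_on_closedBall`). By lower
  semicontinuity every `c < u(x₀)` is a lower bound of `u` near `x₀`, hence everywhere, so `u ≥ u(x₀)`
  for every `x₀`, and `u` is constant.
-/

open Filter Topology Matrix

/-! ### Eigenvalues of a rank-one update of a scalar matrix -/

theorem orderedEigenvalue_mono {N : ℕ} (X : SymMatrix N) : Monotone (orderedEigenvalue X) := by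
  intro i j hij
  apply X.isHermitian.eigenvalues₀_antitone
  simpa [Fin.le_def] using Fin.rev_le_rev.mpr hij

theorem sum_orderedEigenvalue {N : ℕ} (X : SymMatrix N) :
    ∑ i, orderedEigenvalue X i = X.1.trace := by
  rw [X.isHermitian.trace_eq_sum_eigenvalues]
  simp only [RCLike.ofReal_real_eq_id, id]
  unfold orderedEigenvalue Matrix.IsHermitian.eigenvalues
  rw [Equiv.sum_comp (Fintype.equivOfCardEq (Fintype.card_fin _)).symm
      X.isHermitian.eigenvalues₀]
  exact Equiv.sum_comp (Fin.revPerm.trans (finCongr (Fintype.card_fin N).symm))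
      X.isHermitian.eigenvalues₀

theorem exists_eigenvector_orderedEigenvalue {N : ℕ} (X : SymMatrix N) (i : Fin N) :
    ∃ w : Fin N → ℝ, w ≠ 0 ∧ X.1 *ᵥ w = orderedEigenvalue X i • w := by
  set e : Fin (Fintype.card (Fin N)) ≃ Fin N := Fintype.equivOfCardEq (Fintype.card_fin _)
  set j := e (Fin.cast (Fintype.card_fin N).symm i.rev) with hj
  refine ⟨⇑(X.isHermitian.eigenvectorBasis j), ?_, ?_⟩
  · intro h
    apply X.isHermitian.eigenvectorBasis.orthonormal.ne_zero j
    ext l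
    exact congrFun h l
  · rw [X.isHermitian.mulVec_eigenvectorBasis]
    congr 1
    simp [orderedEigenvalue, Matrix.IsHermitian.eigenvalues, hj, e]

/-- An eigenvector of `α I + β v vᵀ` is orthogonal to `v`, with eigenvalue `α`, or its eigenvalue is
that of `v`. -/
theorem orderedEigenvalue_eq_or_eq {N : ℕ} {X : SymMatrix N} {α β : ℝ} {v : Fin N → ℝ}
    (hX : X.1 = α • (1 : Matrix (Fin N) (Fin N) ℝ) + β • vecMulVec v v) (i : Fin N) :
    orderedEigenvalue X i = α ∨ orderedEigenvalue X i = α + β * (v ⬝ᵥ v) := by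
  obtain ⟨w, hw, h⟩ := exists_eigenvector_orderedEigenvalue X i
  have h1 : ∀ l, α * w l + β * (v l * (v ⬝ᵥ w)) = orderedEigenvalue X i * w l := by
    intro l
    have := congrFun h l
    rw [hX] at this
    simpa [Matrix.add_mulVec, Matrix.smul_mulVec, vecMulVec_mulVec, mul_comm] using this
  by_cases h0 : v ⬝ᵥ w = 0
  · left
    obtain ⟨l, hl⟩ := Function.ne_iff.mp hw
    have := h1 l
    rw [h0] at this
    exact (mul_right_cancel₀ hl (by linarith)).symm
  · right
    -- Pair the eigenvalue equation with `v`.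
    have h2 : α * (v ⬝ᵥ w) + β * ((v ⬝ᵥ v) * (v ⬝ᵥ w)) = orderedEigenvalue X i * (v ⬝ᵥ w) := by
      have : ∑ l, v l * (α * w l + β * (v l * (v ⬝ᵥ w)))
          = ∑ l, v l * (orderedEigenvalue X i * w l) :=
        Finset.sum_congr rfl fun l _ => by rw [h1 l]
      have e1 : ∑ l, v l * (α * w l + β * (v l * (v ⬝ᵥ w)))
          = α * (v ⬝ᵥ w) + β * ((v ⬝ᵥ v) * (v ⬝ᵥ w)) := by
        conv_rhs => rw [dotProduct, dotProduct, Finset.sum_mul, Finset.mul_sum, Finset.mul_sum,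
          ← Finset.sum_add_distrib]
        exact Finset.sum_congr rfl fun l _ => by simp only [dotProduct]; ring
      have e2 : ∑ l, v l * (orderedEigenvalue X i * w l) = orderedEigenvalue X i * (v ⬝ᵥ w) := by
        rw [dotProduct, Finset.mul_sum]
        exact Finset.sum_congr rfl fun l _ => by ring
      rw [← e1, this, e2]
    exact mul_right_cancel₀ h0 (by linarith)

/-- The top eigenvalue of `α I + β v vᵀ`, `β ≥ 0`, is `α + β |v|²`, and the others are `α`. Every
eigenvalue is one of these two numbers, and the trace fixes the multiplicities. -/
theorem orderedEigenvalue_of_rankOneUpdate {N : ℕ} {X : SymMatrix N} {α β : ℝ} {v : Fin N → ℝ}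
    (hβ : 0 ≤ β) (hX : X.1 = α • (1 : Matrix (Fin N) (Fin N) ℝ) + β • vecMulVec v v) (i : Fin N) :
    orderedEigenvalue X i = α + if i.val + 1 = N then β * (v ⬝ᵥ v) else 0 := by
  set B := β * (v ⬝ᵥ v) with hB
  have hB0 : 0 ≤ B := mul_nonneg hβ (Finset.sum_nonneg fun l _ => mul_self_nonneg _)
  have hor := orderedEigenvalue_eq_or_eq hX
  have hsum : ∑ j, (orderedEigenvalue X j - α) = B := by
    rw [Finset.sum_sub_distrib, sum_orderedEigenvalue, hX]
    simp [Matrix.trace_add, Matrix.trace_smul, trace_vecMulVec, hB]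
    ring
  have hnn : ∀ j, 0 ≤ orderedEigenvalue X j - α := fun j => by
    rcases hor j with h | h <;> linarith
  have hN : 0 < N := i.pos
  set t : Fin N := ⟨N - 1, by omega⟩ with ht
  have htop : orderedEigenvalue X t = α + B := by
    rcases hor t with h | h
    · have : ∑ j, (orderedEigenvalue X j - α) ≤ 0 := Finset.sum_nonpos fun j _ => by
        have : orderedEigenvalue X j ≤ orderedEigenvalue X t :=
          orderedEigenvalue_mono X (by simp [ht, Fin.le_def]; omega)
        linarith
      linarith
    · exact h
  split_ifs with hi
  · have : i = t := by ext; simp [ht]; omega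
    rw [this, htop]
  · have hit : i ≠ t := fun h => hi (by rw [h, ht]; simp; omega)
    have := Finset.add_le_sum (s := Finset.univ) (f := fun j => orderedEigenvalue X j - α)
      (fun j _ => hnn j) (Finset.mem_univ i) (Finset.mem_univ t) hit
    simp only [hsum, htop] at this
    linarith [hnn i]

theorem partialSumPlus_of_rankOneUpdate {N k : ℕ} (hk : 1 ≤ k) (hkN : k ≤ N) {X : SymMatrix N}
    {α β : ℝ} {v : Fin N → ℝ} (hβ : 0 ≤ β)
    (hX : X.1 = α • (1 : Matrix (Fin N) (Fin N) ℝ) + β • vecMulVec v v) :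
    partialSumPlus k X = k * α + β * (v ⬝ᵥ v) := by
  have hcard : (Finset.univ.filter fun i : Fin N => N ≤ i.val + k).card = k := by
    have h := Fin.card_filter_val_lt (n := N) (m := k)
    rw [min_eq_right hkN] at h
    rw [← h]
    refine Finset.card_bij' (fun i _ => i.rev) (fun i _ => i.rev) ?_ ?_ ?_ ?_ <;>
      simp [Fin.val_rev] <;> omega
  unfold partialSumPlus
  rw [Finset.sum_congr rfl fun i _ => orderedEigenvalue_of_rankOneUpdate hβ hX i,
    Finset.sum_add_distrib, Finset.sum_const, hcard, nsmul_eq_mul]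
  congr 1
  rw [Finset.sum_eq_single_of_mem (⟨N - 1, by omega⟩ : Fin N) (by simp; omega)]
  · rw [if_pos (by simp; omega)]
  · intro j _ hj
    refine if_neg fun h => hj ?_
    ext
    simp
    omega

theorem partialSumMinus_of_rankOneUpdate {N k : ℕ} (hkN : k < N) {X : SymMatrix N}
    {α β : ℝ} {v : Fin N → ℝ} (hβ : 0 ≤ β)
    (hX : X.1 = α • (1 : Matrix (Fin N) (Fin N) ℝ) + β • vecMulVec v v) :
    partialSumMinus k X = k * α := by
  unfold partialSumMinus
  rw [Finset.sum_congr rfl fun i hi => (orderedEigenvalue_of_rankOneUpdate hβ hX i).trans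
    (show _ = α by rw [if_neg (by simp at hi; omega), add_zero]),
    Finset.sum_const, nsmul_eq_mul, Fin.card_filter_val_lt, min_eq_right hkN.le]

/-! ### Hessians of composite functions -/

theorem fderiv_fderiv_comp_apply {E : Type*} [NormedAddCommGroup E] [NormedSpace ℝ E]
    {q : E → ℝ} (hq : ContDiff ℝ 2 q) {g g' : ℝ → ℝ} {g'' : ℝ} {x : E}
    (hg : ∀ᶠ s in 𝓝 (q x), HasDerivAt g (g' s) s) (hg' : HasDerivAt g' g'' (q x)) (a b : E) :
    fderiv ℝ (fderiv ℝ fun y => g (q y)) x a b =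
      g' (q x) * fderiv ℝ (fderiv ℝ q) x a b + g'' * (fderiv ℝ q x a * fderiv ℝ q x b) := by
  have hd : Differentiable ℝ q := hq.differentiable (by norm_num)
  have hd' : Differentiable ℝ (fderiv ℝ q) :=
    (hq.fderiv_right (m := 1) (by norm_num)).differentiable (by norm_num)
  have h1 : (fderiv ℝ fun y => g (q y)) =ᶠ[𝓝 x] fun y => g' (q y) • fderiv ℝ q y := by
    filter_upwards [hd.continuous.continuousAt.eventually hg] with y hy
    exact (hy.comp_hasFDerivAt y (hd y).hasFDerivAt).fderiv
  have h2 : HasFDerivAt (fun y => g' (q y) • fderiv ℝ q y) _ x :=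
    (hg'.comp_hasFDerivAt x (hd x).hasFDerivAt).smul (hd' x).hasFDerivAt
  rw [h1.fderiv_eq, h2.fderiv]
  simp
  ring

theorem hessianMatrix_radial {N : ℕ} {g g' : ℝ → ℝ} {g'' : ℝ} (x₀ x : EuclideanSpace ℝ (Fin N))
    (hg : ∀ᶠ s in 𝓝 (‖x - x₀‖ ^ 2), HasDerivAt g (g' s) s)
    (hg' : HasDerivAt g' g'' (‖x - x₀‖ ^ 2)) :
    hessianMatrix (fun y => g (‖y - x₀‖ ^ 2)) x =
      (2 * g' (‖x - x₀‖ ^ 2)) • (1 : Matrix (Fin N) (Fin N) ℝ) +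
        (4 * g'') • vecMulVec (x - x₀).ofLp (x - x₀).ofLp := by
  have hq : ContDiff ℝ 2 fun y : EuclideanSpace ℝ (Fin N) => ‖y - x₀‖ ^ 2 :=
    (contDiff_id.sub contDiff_const).norm_sq ℝ
  have h1 : (fderiv ℝ fun y : EuclideanSpace ℝ (Fin N) => ‖y - x₀‖ ^ 2) =
      fun y => (2 : ℝ) • innerSL ℝ (y - x₀) := by
    funext y
    have h : HasFDerivAt (fun y : EuclideanSpace ℝ (Fin N) => ‖y - x₀‖ ^ 2) _ y :=
      ((hasFDerivAt_id y).sub_const x₀).norm_sq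
    rw [h.fderiv]
    ext w
    simp
  have h2 : fderiv ℝ (fun y : EuclideanSpace ℝ (Fin N) =>
      (2 : ℝ) • innerSL ℝ (y - x₀)) x = (2 : ℝ) • innerSL ℝ :=
    (((innerSL ℝ (E := EuclideanSpace ℝ (Fin N))).hasFDerivAt.comp x
      ((hasFDerivAt_id x).sub_const x₀)).const_smul (2 : ℝ)).fderiv
  ext i j
  simp only [hessianMatrix, Matrix.of_apply]
  rw [fderiv_fderiv_comp_apply hq hg hg', h1, h2]
  have h3 : innerSL ℝ (EuclideanSpace.single i (1 : ℝ)) (EuclideanSpace.single j 1) =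
      (1 : Matrix (Fin N) (Fin N) ℝ) i j := by
    rw [innerSL_apply_apply, EuclideanSpace.inner_single_left]
    simp [Matrix.one_apply]
  simp only [_root_.smul_apply, h3]
  simp [vecMulVec_apply, EuclideanSpace.inner_single_right]
  ring

theorem hessianMatrix_coordinate {N : ℕ} {f : ℝ → ℝ} (hf : ContDiff ℝ 2 f) (i : Fin N)
    (x : EuclideanSpace ℝ (Fin N)) :
    hessianMatrix (fun y => f (y i)) x =
      (0 : ℝ) • (1 : Matrix (Fin N) (Fin N) ℝ) +
        (deriv (deriv f) (x i)) • vecMulVec (Pi.single i 1) (Pi.single i 1) := by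
  have hf1 : Differentiable ℝ f := hf.differentiable (by norm_num)
  have hf2 : Differentiable ℝ (deriv f) :=
    (contDiff_succ_iff_deriv (n := 1).mp hf).2.2.differentiable (by norm_num)
  have h1 : (fderiv ℝ fun y : EuclideanSpace ℝ (Fin N) => y i) =
      fun _ => EuclideanSpace.proj i :=
    funext fun y => (EuclideanSpace.proj (𝕜 := ℝ) i).hasFDerivAt.fderiv
  ext l j
  simp only [hessianMatrix, Matrix.of_apply]
  rw [fderiv_fderiv_comp_apply (q := fun y : EuclideanSpace ℝ (Fin N) => y i)
    (EuclideanSpace.proj (𝕜 := ℝ) i).contDiff (Eventually.of_forall fun s => (hf1 s).hasDerivAt)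
    (hf2 (x i)).hasDerivAt, h1]
  simp [vecMulVec_apply, Pi.single_apply, eq_comm]

/-! ### Inverse powers of the distance -/

theorem contDiffAt_inversePower {N : ℕ} {x₀ x : EuclideanSpace ℝ (Fin N)} {a b C : ℝ}
    (ht : 0 < b + ‖x - x₀‖ ^ 2) :
    ContDiffAt ℝ 2 (fun y => C * (b + ‖y - x₀‖ ^ 2) ^ (-a)) x :=
  contDiffAt_const.mul ((contDiffAt_const.add
    ((contDiffAt_id.sub contDiffAt_const).norm_sq ℝ)).rpow_const_of_ne ht.ne')

/-- Positivity of `a` and `C` makes the radial direction the one of the largest eigenvalue of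
the Hessian, so that `P⁺_k` sees it for every `k ≥ 1`. -/
theorem partialSumPlus_hessian_inversePower {N k : ℕ} (hk : 1 ≤ k) (hkN : k ≤ N)
    {x₀ x : EuclideanSpace ℝ (Fin N)} {a b C : ℝ} (ha : 0 < a) (hC : 0 < C)
    (ht : 0 < b + ‖x - x₀‖ ^ 2)
    (hu : ContDiffAt ℝ 2 (fun y => C * (b + ‖y - x₀‖ ^ 2) ^ (-a)) x) :
    partialSumPlus k (hessian _ x hu) =
      2 * a * C * (b + ‖x - x₀‖ ^ 2) ^ (-a - 2) *
        (2 * (a + 1) * ‖x - x₀‖ ^ 2 - k * (b + ‖x - x₀‖ ^ 2)) := by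
  have hg : ∀ (p D s : ℝ), 0 < b + s →
      HasDerivAt (fun s => D * (b + s) ^ p) (D * p * (b + s) ^ (p - 1)) s := by
    intro p D s hs
    have h := (((hasDerivAt_id s).const_add b).rpow_const (p := p) (Or.inl hs.ne')).const_mul D
    simpa only [id, one_mul, mul_assoc] using h
  have hev : ∀ᶠ s in 𝓝 (‖x - x₀‖ ^ 2), 0 < b + s :=
    (continuous_const.add continuous_id).continuousAt.eventually (lt_mem_nhds ht)
  have hX := hessianMatrix_radial x₀ x (hev.mono fun s hs => hg (-a) C s hs)
    (hg (-a - 1) (C * -a) _ ht)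
  have hpos : 0 < (b + ‖x - x₀‖ ^ 2) ^ (-a - 1 - 1) := Real.rpow_pos_of_pos ht _
  have hdot : (x - x₀).ofLp ⬝ᵥ (x - x₀).ofLp = ‖x - x₀‖ ^ 2 := by
    rw [EuclideanSpace.real_norm_sq_eq]
    exact Finset.sum_congr rfl fun l _ => (sq _).symm
  rw [partialSumPlus_of_rankOneUpdate hk hkN
    (mul_nonneg (by norm_num) (mul_nonneg (by nlinarith [mul_pos hC ha]) hpos.le)) hX, hdot]
  have e1 : (b + ‖x - x₀‖ ^ 2) ^ (-a - 1) =
      (b + ‖x - x₀‖ ^ 2) ^ (-a - 2) * (b + ‖x - x₀‖ ^ 2) := by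
    rw [← Real.rpow_add_one ht.ne']
    congr 1
    ring
  rw [e1, show -a - 1 - 1 = -a - 2 by ring]
  ring

/-! ### The Liouville property for `k ≤ 2` -/

/-- Comparison with the barrier `c (ρ² / |y - x₀|²)^a` outside a ball. -/
theorem IsViscositySupersolution.barrier_le {N k : ℕ} (hk : 1 ≤ k) (hk2 : k ≤ 2) (hkN : k ≤ N)
    {u : EuclideanSpace ℝ (Fin N) → ℝ} (hu0 : ∀ x, 0 ≤ u x)
    (hu : IsViscositySupersolution (partialSumPlus k) u) {x₀ : EuclideanSpace ℝ (Fin N)}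
    {ρ c : ℝ} (hρ : 0 < ρ) (hc : 0 < c) (hball : ∀ x, ‖x - x₀‖ ≤ ρ → c ≤ u x)
    {a : ℝ} (ha : 0 < a) {y : EuclideanSpace ℝ (Fin N)} (hy : ρ < ‖y - x₀‖) :
    c * (ρ ^ 2) ^ a * (0 + ‖y - x₀‖ ^ 2) ^ (-a) ≤ u y := by
  set C := c * (ρ ^ 2) ^ a with hCdef
  have hC : 0 < C := mul_pos hc (Real.rpow_pos_of_pos (by positivity) _)
  set φ : EuclideanSpace ℝ (Fin N) → ℝ := fun z => C * (0 + ‖z - x₀‖ ^ 2) ^ (-a) with hφ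
  by_contra! hlt
  change u y < φ y at hlt
  -- Cut off the exterior domain at a radius `R` where the barrier is below the gap `φ y - u y`.
  have hlim : Tendsto (fun R : ℝ => C * (0 + R ^ 2) ^ (-a)) atTop (𝓝 0) := by
    have h := ((tendsto_rpow_neg_atTop ha).comp (tendsto_pow_atTop (α := ℝ) two_ne_zero)).const_mul C
    simpa [Function.comp_def] using h
  obtain ⟨R, hR, hyR⟩ := ((hlim.eventually (gt_mem_nhds (sub_pos.mpr hlt))).and
    (eventually_gt_atTop ‖y - x₀‖)).exists
  set K : Set (EuclideanSpace ℝ (Fin N)) := {z | ρ ≤ ‖z - x₀‖ ∧ ‖z - x₀‖ ≤ R}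
  have hcn : Continuous fun z : EuclideanSpace ℝ (Fin N) => ‖z - x₀‖ := by fun_prop
  have hK : IsCompact K := by
    refine (isCompact_closedBall x₀ R).of_isClosed_subset
      ((isClosed_le continuous_const hcn).inter (isClosed_le hcn continuous_const)) fun z hz => ?_
    simpa [dist_eq_norm] using hz.2
  have hpos : ∀ z, ρ ≤ ‖z - x₀‖ → 0 < 0 + ‖z - x₀‖ ^ 2 := fun z hz => by
    have : 0 < ‖z - x₀‖ := hρ.trans_le hz
    positivity
  have hlsc : LowerSemicontinuousOn (fun z => u z + -φ z) K :=
    (hu.1.lowerSemicontinuousOn K).add (ContinuousOn.lowerSemicontinuousOn fun z hz =>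
      (contDiffAt_inversePower (hpos z hz.1)).continuousAt.neg.continuousWithinAt)
  have hyK : y ∈ K := ⟨hy.le, hyR.le⟩
  obtain ⟨z, hzK, hz⟩ := hlsc.exists_isMinOn ⟨y, hyK⟩ hK
  have hzy : u z - φ z ≤ u y - φ y := by
    simpa [sub_eq_add_neg] using isMinOn_iff.mp hz y hyK
  have hzρ : ρ < ‖z - x₀‖ := by
    refine lt_of_le_of_ne hzK.1 fun h => ?_
    have h1 : φ z = c := by
      simp only [hφ, hCdef, ← h, zero_add]
      rw [mul_assoc, ← Real.rpow_add (by positivity)]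
      simp
    linarith [hball z h.ge]
  have hzR : ‖z - x₀‖ < R := by
    refine lt_of_le_of_ne hzK.2 fun h => ?_
    have h1 : φ z < φ y - u y := by
      simp only [hφ, h]
      exact hR
    linarith [hu0 z]
  have hmin : IsLocalMin (fun w => u w - φ w) z := by
    filter_upwards [hcn.continuousAt.eventually (lt_mem_nhds hzρ),
      hcn.continuousAt.eventually (gt_mem_nhds hzR)] with w h1 h2
    simpa [sub_eq_add_neg] using isMinOn_iff.mp hz w ⟨h1.le, h2.le⟩
  have hcd : ContDiffAt ℝ 2 φ z := contDiffAt_inversePower (hpos z hzK.1)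
  have hle := hu.2 z φ hcd hmin
  rw [partialSumPlus_hessian_inversePower hk hkN ha hC (hpos z hzK.1) hcd] at hle
  have hs := hpos z hzK.1
  have h1 := Real.rpow_pos_of_pos hs (-a - 2)
  have hk2' : (k : ℝ) ≤ 2 := by exact_mod_cast hk2
  refine hle.not_gt (mul_pos (by positivity) ?_)
  nlinarith

theorem IsViscositySupersolution.le_of_le_on_closedBall {N k : ℕ} (hk : 1 ≤ k) (hk2 : k ≤ 2)
    (hkN : k ≤ N) {u : EuclideanSpace ℝ (Fin N) → ℝ} (hu0 : ∀ x, 0 ≤ u x)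
    (hu : IsViscositySupersolution (partialSumPlus k) u) {x₀ : EuclideanSpace ℝ (Fin N)}
    {ρ c : ℝ} (hρ : 0 < ρ) (hc : 0 < c) (hball : ∀ x, ‖x - x₀‖ ≤ ρ → c ≤ u x)
    (y : EuclideanSpace ℝ (Fin N)) : c ≤ u y := by
  rcases le_or_gt ‖y - x₀‖ ρ with hy | hy
  · exact hball y hy
  have hs : 0 < 0 + ‖y - x₀‖ ^ 2 := by
    have := hρ.trans hy
    positivity
  have hcont : Continuous fun a : ℝ => c * (ρ ^ 2) ^ a * (0 + ‖y - x₀‖ ^ 2) ^ (-a) :=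
    (continuous_const.mul (Real.continuous_const_rpow (by positivity))).mul
      ((Real.continuous_const_rpow hs.ne').comp continuous_neg)
  have hlim := (hcont.tendsto 0).mono_left (nhdsWithin_le_nhds (s := Set.Ioi 0))
  simp only [neg_zero, Real.rpow_zero, mul_one] at hlim
  refine le_of_tendsto hlim ?_
  filter_upwards [self_mem_nhdsWithin] with a ha
  exact hu.barrier_le hk hk2 hkN hu0 hρ hc hball ha hy

theorem IsViscositySupersolution.eq_const {N k : ℕ} (hk : 1 ≤ k) (hk2 : k ≤ 2) (hkN : k ≤ N)
    {u : EuclideanSpace ℝ (Fin N) → ℝ} (hu0 : ∀ x, 0 ≤ u x)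
    (hu : IsViscositySupersolution (partialSumPlus k) u) : ∃ c, ∀ x, u x = c := by
  have hle : ∀ x y, u x ≤ u y := by
    intro x y
    refine le_of_forall_lt_imp_le_of_dense fun c hc => ?_
    rcases le_or_gt c 0 with h0 | h0
    · exact h0.trans (hu0 y)
    obtain ⟨ρ, hρ, h⟩ := Metric.nhds_basis_closedBall.eventually_iff.mp (hu.1 x c hc)
    exact hu.le_of_le_on_closedBall hk hk2 hkN hu0 hρ h0
      (fun z hz => (h (by simpa [dist_eq_norm] using hz)).le) y
  exact ⟨u 0, fun x => (hle x 0).antisymm (hle 0 x)⟩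

/-! ### Nonconstant solutions and supersolutions -/

theorem isClassicalSolution_partialSumMinus_coordinate {N k : ℕ} (hkN : k < N) {f : ℝ → ℝ}
    (hf : ContDiff ℝ 2 f) (hconv : ConvexOn ℝ Set.univ f) (i : Fin N) :
    IsClassicalSolution (partialSumMinus k)
      (fun x : EuclideanSpace ℝ (Fin N) => f (x i)) := by
  refine ⟨hf.comp (EuclideanSpace.proj (𝕜 := ℝ) i).contDiff, fun x => ?_⟩
  have hmono : Monotone (deriv f) := monotoneOn_univ.mp
    (hconv.monotoneOn_deriv fun s _ => hf.differentiable (by norm_num) s)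
  rw [partialSumMinus_of_rankOneUpdate hkN hmono.deriv_nonneg (hessianMatrix_coordinate hf i x),
    mul_zero]

theorem not_const_comp_coordinate {N : ℕ} {f : ℝ → ℝ} (hf : ¬ ∃ c, ∀ t, f t = c) (i : Fin N) :
    ¬ ∃ c, ∀ x : EuclideanSpace ℝ (Fin N), f (x i) = c := by
  rintro ⟨c, h⟩
  exact hf ⟨c, fun t => by simpa using h (EuclideanSpace.single i t)⟩

theorem exists_bounded_supersolution {N k : ℕ} (hk : 2 < k) (hkN : k ≤ N) :
    ∃ u : EuclideanSpace ℝ (Fin N) → ℝ,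
      (∀ x, 0 ≤ u x) ∧ (∃ M : ℝ, ∀ x, u x ≤ M) ∧
        IsClassicalSupersolution (partialSumPlus k) u ∧ ¬ ∃ c, ∀ x, u x = c := by
  have hpos : ∀ x : EuclideanSpace ℝ (Fin N), 0 < 1 + ‖x - 0‖ ^ 2 := fun x => by positivity
  refine ⟨fun x => 1 * (1 + ‖x - 0‖ ^ 2) ^ (-(1 / 2 : ℝ)), fun x => by positivity,
    ⟨1, fun x => ?_⟩, ⟨contDiff_iff_contDiffAt.mpr fun x => contDiffAt_inversePower (hpos x),
      fun x => ?_⟩, ?_⟩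
  · beta_reduce
    rw [one_mul]
    exact Real.rpow_le_one_of_one_le_of_nonpos (by nlinarith [norm_nonneg (x - 0)]) (by norm_num)
  · rw [partialSumPlus_hessian_inversePower (by omega) hkN (by norm_num) one_pos (hpos x)]
    have hk' : (3 : ℝ) ≤ k := by exact_mod_cast hk
    refine mul_nonpos_of_nonneg_of_nonpos
      (mul_nonneg (by norm_num) (Real.rpow_nonneg (hpos x).le _)) ?_
    nlinarith [sq_nonneg ‖x - 0‖]
  -- The values at `0` and at a unit vector are `1` and `2 ^ (-1/2)`.
  · rintro ⟨c, h⟩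
    have h0 := h 0
    have h1 := h (EuclideanSpace.single ⟨0, by omega⟩ 1)
    rw [← h0] at h1
    have : ((1 : ℝ) + 1) ^ (-(1 / 2 : ℝ)) < 1 :=
      Real.rpow_lt_one_of_one_lt_of_neg (by norm_num) (by norm_num)
    simp at h1
    norm_num at this h1
    linarith


theorem theorem1p1 (N k : ℕ) (hk : 1 ≤ k) (hkN : k < N) :
    -- the operator `P⁻_k`: nonconstant nonnegative classical solutions exist, ...
    (∃ u : EuclideanSpace ℝ (Fin N) → ℝ,
      (∀ x, 0 ≤ u x) ∧ IsClassicalSolution (partialSumMinus k) u ∧ ¬ ∃ c, ∀ x, u x = c) ∧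
    -- ... for example `u(x) = f(x_i)` with `f` convex
    (∀ f : ℝ → ℝ, ContDiff ℝ 2 f → ConvexOn ℝ Set.univ f → (∀ t, 0 ≤ f t) →
      (¬ ∃ c, ∀ t, f t = c) → ∀ i : Fin N,
        (∀ x : EuclideanSpace ℝ (Fin N), 0 ≤ f (x i)) ∧
        IsClassicalSolution (partialSumMinus k) (fun x : EuclideanSpace ℝ (Fin N) => f (x i)) ∧
        ¬ ∃ c, ∀ x : EuclideanSpace ℝ (Fin N), f (x i) = c) ∧
    -- the operator `P⁺_k` with `k = 1` or `k = 2`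
    (k = 1 ∨ k = 2 → ∀ u : EuclideanSpace ℝ (Fin N) → ℝ,
      (∀ x, 0 ≤ u x) → IsViscositySupersolution (partialSumPlus k) u → ∃ c, ∀ x, u x = c) ∧
    -- the operator `P⁺_k` with `k > 2`
    (2 < k → ∃ u : EuclideanSpace ℝ (Fin N) → ℝ,
      (∀ x, 0 ≤ u x) ∧ (∃ M : ℝ, ∀ x, u x ≤ M) ∧
        IsClassicalSupersolution (partialSumPlus k) u ∧ ¬ ∃ c, ∀ x, u x = c) := by
  have hcoord := fun (f : ℝ → ℝ) (hf : ContDiff ℝ 2 f) (hconv : ConvexOn ℝ Set.univ f)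
      (i : Fin N) => isClassicalSolution_partialSumMinus_coordinate hkN hf hconv i
  refine ⟨?_, fun f hf hconv hf0 hne i => ⟨fun x => hf0 _, hcoord f hf hconv i,
    not_const_comp_coordinate hne i⟩, fun hk12 u hu0 hu =>
      hu.eq_const hk (by omega) hkN.le hu0, fun hk2 => exists_bounded_supersolution hk2 hkN.le⟩
  refine ⟨fun x => (x ⟨0, by omega⟩) ^ 2, fun x => sq_nonneg _,
    hcoord (fun t => t ^ 2) (by fun_prop) (Even.convexOn_pow (by norm_num)) _,
    not_const_comp_coordinate (f := fun t => t ^ 2) ?_ _⟩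
  rintro ⟨c, h⟩
  have h0 := h 0
  have h1 := h 1
  norm_num at h0 h1
  linarith
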